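/- Let $\mathrm{F\text{-}S}$ be the classical realist causal-inferential theory. It is the process theory (symmetric monoidal category) in which every system consists of a causal finite set $\Lambda$ and an inferential finite set $X$, both composed by Cartesian product, with trivial system $\star=\{*\}$. Its processes are the diagrams built from: substochastic maps on inferential systems; for all finite sets $\Lambda,\Lambda'$ a generator $\mathrm{prep}$ that takes the causal input $\Lambda$ to the causal output $\Lambda'$ by the function read from an inferential input ranging over the set $[\Lambda\to\Lambda']$ of all functions; for every $\Lambda$ a generator $\mathrm{know}$ that passes on the causal system $\Lambda$ and outputs knowledge of it on an inferential system $\Lambda$; and for every $\Lambda$ a generator $\mathrm{ignore}$ with causal input $\Lambda$ and no output. A function $f:\Lambda\to\Lambda'$ is embedded as $\mathrm{prep}$ with the point distribution $[f]$. Diagrams are taken modulo deformation and the following rules: substochastic maps compose as such; identity and swap functions are embedded as causal wires; two $\mathrm{prep}$'s in sequence or in parallel equal one $\mathrm{prep}$ applied to the sequential, respectively parallel, composite of the functions; $\mathrm{know}$ followed by marginalisation of its outcome is the identity, $\mathrm{know}$ performed twice is $\mathrm{know}$ followed by copying the outcome, and $\mathrm{know}$ on $\Lambda\times\Lambda'$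 is $\mathrm{know}$ on $\Lambda$ in parallel with $\mathrm{know}$ on $\Lambda'$; $\mathrm{ignore}$ on $\Lambda\times\Lambda'$ is the parallel composite of the $\mathrm{ignore}$'s and $\mathrm{ignore}$ on $\star$ is trivial; ignoring the output of $\mathrm{prep}$ equals marginalising its function input and ignoring its causal input; and $\mathrm{prep}$ followed by $\mathrm{know}$ equals $\mathrm{know}$ on the causal input, copying the function input, $\mathrm{prep}$ with one copy, and outputting on the inferential side the value of the function (other copy) at the known input. A process is causally closed if its causal input and output are trivial. Let $\mathbf p^*$ be a prediction map: a map from causally closed processes to substochastic maps that preserves sequential and parallel composition and sends every substochastic map, viewed as a process, to itself. A tester for processes $(\Lambda,X)\to(\Lambda',Y)$ consists of a process $x:(\star,X_0)\to(\Lambda,X)\otimes W$ and a process $y:(\Lambda',Y)\otimes W\to(\star,Y_0)$ for some system $W$; inserting $\mathcal D$ gives the causally closed process $y\circ(\mathcal D\otimes \mathrm{id}_W)\circ x$. Two processes $\mathcal D,\mathcal E:(\Lambda,X)\to(\Lambda',Y)$ are inferentially equivalent, $\mathcal D\sim_{\mathbf p^*}\mathcal E$, if for every tester the two causally closed processes obtained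 by inserting $\mathcal D$ and $\mathcal E$ have the same image under $\mathbf p^*$. The substochastic map associated with $\mathcal D$ is the map $X\times\Lambda\to Y\times\Lambda'$ obtained by applying $\mathbf p^*$ to the causally closed process in which the causal input $\Lambda$ of $\mathcal D$ is prepared from an inferential system $\Lambda$ (by $\mathrm{prep}:\star\to\Lambda$, through the bijection $\Lambda\cong[\star\to\Lambda]$), and the causal output $\Lambda'$ is fed into $\mathrm{know}$ and then ignored, the outcome of $\mathrm{know}$ being an additional inferential output $\Lambda'$. Then for all processes $\mathcal D,\mathcal E:(\Lambda,X)\to(\Lambda',Y)$ of $\mathrm{F\text{-}S}$ (with possibly nontrivial causal input and output), $\mathcal D\sim_{\mathbf p^*}\mathcal E$ if and only if $\mathcal D$ and $\mathcal E$ have the same associated substochastic map. -/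

import Mathlib

open scoped NNReal

/-! ## Finite sets, functions and substochastic maps -/

/-- A finite set (an ontic state space of a causal system, or the value set of an
inferential system). It may be empty. -/
structure FinSet : Type 1 where
  carrier : Type
  [fin : Fintype carrier]
  [dec : DecidableEq carrier]

instance : CoeSort FinSet Type := ⟨FinSet.carrier⟩

instance (A : FinSet) : Fintype A := A.fin

instance (A : FinSet) : DecidableEq A := A.dec

namespace FinSet

/-- The trivial system `⋆`. -/
abbrev star : FinSet := ⟨Unit⟩

/-- The Cartesian product, which is the composite of systems. -/
abbrev prod (A B : FinSet) : FinSet := ⟨A.carrier × B.carrier⟩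

/-- The finite set of all functions from `A` to `B`. -/
abbrev hom (A B : FinSet) : FinSet := ⟨A.carrier → B.carrier⟩

end FinSet

/-- A substochastic map from `X` to `Y`: `s x y` is the weight of `y` given `x`. -/
@[ext]
structure SubStoch (X Y : FinSet) where
  weight : X → Y → ℝ≥0
  sum_le : ∀ x, ∑ y, weight x y ≤ 1

namespace SubStoch

/-- The deterministic map given by a function. -/
def det {X Y : FinSet} (f : X → Y) : SubStoch X Y where
  weight x y := if f x = y then 1 else 0
  sum_le x := by simp

/-- The identity map. -/
def id (X : FinSet) : SubStoch X X := det fun x => x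

/-- Sequential composition, `s` first. -/
def comp {X Y Z : FinSet} (s : SubStoch X Y) (t : SubStoch Y Z) : SubStoch X Z where
  weight x z := ∑ y, s.weight x y * t.weight y z
  sum_le x := by
    rw [Finset.sum_comm]
    calc ∑ y, ∑ z, s.weight x y * t.weight y z
        = ∑ y, s.weight x y * ∑ z, t.weight y z := by simp [Finset.mul_sum]
      _ ≤ ∑ y, s.weight x y * 1 := by
          gcongr with y
          exact t.sum_le y
      _ ≤ 1 := by simpa using s.sum_le x

/-- Parallel composition. -/
def tensor {X Y X' Y' : FinSet} (s : SubStoch X Y) (t : SubStoch X' Y') :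
    SubStoch (X.prod X') (Y.prod Y') where
  weight x y := s.weight x.1 y.1 * t.weight x.2 y.2
  sum_le x := by
    have h : ∑ y : Y.carrier × Y'.carrier, s.weight x.1 y.1 * t.weight x.2 y.2
        = (∑ y, s.weight x.1 y) * ∑ y', t.weight x.2 y' := by
      rw [Fintype.sum_prod_type, Finset.sum_mul_sum]
    exact h.trans_le (mul_le_one' (s.sum_le _) (t.sum_le _))

/-- Marginalisation, which is also the tautological propositional effect. -/
def discard (X : FinSet) : SubStoch X FinSet.star := det fun _ => ()

/-- The point distribution `[x]`. -/
def point {X : FinSet} (x : X) : SubStoch FinSet.star X := det fun _ => x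

end SubStoch

/-! ## The classical realist causal-inferential theory -/

/-- A system of the theory. Causal wires (drawn vertically) compose by Cartesian product, and so
do inferential wires (drawn horizontally), so a collection of wires is given by one causal
and one inferential finite set. -/
structure Sys : Type 1 where
  caus : FinSet
  inf : FinSet

namespace Sys

/-- The composite of two systems. -/
abbrev tensor (S T : Sys) : Sys := ⟨S.caus.prod T.caus, S.inf.prod T.inf⟩

/-- The trivial system. -/
abbrev unit : Sys := ⟨FinSet.star, FinSet.star⟩

end Sys

/-- Formal diagrams, read from input to output.

* `embed f s` is the functional mechanism `f` on the causal wires next to the substochastic map `s`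
  on the inferential wires. With `f` the identity it is a substochastic map viewed as
  a process. The rewrite rule `Rewrite.embed_eq` says that the mechanism `f` is nothing but
  the generator `prep` with a point state of knowledge `[f]`.
  The wirings (identity, swap, rebracketing, trivial wires) are of this form.
* `prep A B` takes a causal system `A` and a function from `A` to `B`, read from an inferential
  wire, to the causal system `B`.
* `know A` gains knowledge from (asks a question about) the causal system `A`, which goes on.
* `ignore A` ignores the causal system `A`. -/
inductive Diagram : Sys → Sys → Type 1
  | embed {A B X Y : FinSet} (f : A → B) (s : SubStoch X Y) : Diagram ⟨A, X⟩ ⟨B, Y⟩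
  | prep (A B : FinSet) : Diagram ⟨A, A.hom B⟩ ⟨B, FinSet.star⟩
  | know (A : FinSet) : Diagram ⟨A, FinSet.star⟩ ⟨A, A⟩
  | ignore (A : FinSet) : Diagram ⟨A, FinSet.star⟩ ⟨FinSet.star, FinSet.star⟩
  | id (S : Sys) : Diagram S S
  | comp {S T U : Sys} (D : Diagram S T) (E : Diagram T U) : Diagram S U
  | tensor {S T S' T' : Sys} (D : Diagram S T) (E : Diagram S' T') :
      Diagram (S.tensor S') (T.tensor T')

namespace Diagram

/-- A substochastic map on the inferential wires, next to an untouched causal wire `A`. -/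
abbrev infer (A : FinSet) {X Y : FinSet} (s : SubStoch X Y) : Diagram ⟨A, X⟩ ⟨A, Y⟩ :=
  embed (fun a => a) s

/-- A function on the inferential wires, next to an untouched causal wire `A`. -/
abbrev relabel (A X Y : FinSet) (g : X → Y) : Diagram ⟨A, X⟩ ⟨A, Y⟩ :=
  infer A (SubStoch.det g)

/-- Rebracketing of wires. -/
abbrev assocWire (S T U : Sys) : Diagram ((S.tensor T).tensor U) (S.tensor (T.tensor U)) :=
  embed (fun a => (a.1.1, (a.1.2, a.2))) (SubStoch.det fun x => (x.1.1, (x.1.2, x.2)))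

/-- Removal of trivial wires on the left. -/
abbrev leftUnitWire (S : Sys) : Diagram (Sys.unit.tensor S) S :=
  embed (fun a => a.2) (SubStoch.det fun x => x.2)

/-- Removal of trivial wires on the right. -/
abbrev rightUnitWire (S : Sys) : Diagram (S.tensor Sys.unit) S :=
  embed (fun a => a.1) (SubStoch.det fun x => x.1)

/-- Crossing of wires. -/
abbrev swapWire (S T : Sys) : Diagram (S.tensor T) (T.tensor S) :=
  embed (fun a => (a.2, a.1)) (SubStoch.det fun x => (x.2, x.1))

/-- The diagram `D` next to an inferential wire `Z`. -/
def nextTo {A B X Y : FinSet} (D : Diagram ⟨A, X⟩ ⟨B, Y⟩) (Z : FinSet) :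
    Diagram ⟨A, X.prod Z⟩ ⟨B, Y.prod Z⟩ :=
  comp (T := ⟨A.prod FinSet.star, X.prod Z⟩)
    (embed (fun a => (a, ())) (SubStoch.id (X.prod Z)))
    (comp (T := ⟨B.prod FinSet.star, Y.prod Z⟩)
      (tensor D (Diagram.id ⟨FinSet.star, Z⟩))
      (embed (fun b => b.1) (SubStoch.id (Y.prod Z))))

end Diagram

open Diagram in
/-- The congruence on diagrams generated by deformation of diagrams (the laws of a symmetric
monoidal category), by composition within functions and within substochastic maps, and by the
rewrite rules of the three generators. (The coherence laws between the wirings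
follow from `embed_id`, `embed_comp` and `embed_tensor`.) -/
inductive Rewrite : ∀ {S T : Sys}, Diagram S T → Diagram S T → Prop
  -- equivalence relation and congruence
  | refl {S T : Sys} (D : Diagram S T) : Rewrite D D
  | symm {S T : Sys} {D E : Diagram S T} : Rewrite D E → Rewrite E D
  | trans {S T : Sys} {D E F : Diagram S T} : Rewrite D E → Rewrite E F → Rewrite D F
  | comp {S T U : Sys} {D D' : Diagram S T} {E E' : Diagram T U} :
      Rewrite D D' → Rewrite E E' → Rewrite (D.comp E) (D'.comp E')
  | tensor {S T S' T' : Sys} {D D' : Diagram S T} {E E' : Diagram S' T'} :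
      Rewrite D D' → Rewrite E E' → Rewrite (D.tensor E) (D'.tensor E')
  -- deformation of diagrams
  | id_comp {S T : Sys} (D : Diagram S T) : Rewrite ((Diagram.id S).comp D) D
  | comp_id {S T : Sys} (D : Diagram S T) : Rewrite (D.comp (Diagram.id T)) D
  | assoc {S T U V : Sys} (D : Diagram S T) (E : Diagram T U) (F : Diagram U V) :
      Rewrite ((D.comp E).comp F) (D.comp (E.comp F))
  | id_tensor (S T : Sys) :
      Rewrite ((Diagram.id S).tensor (Diagram.id T)) (Diagram.id (S.tensor T))
  | interchange {S T U S' T' U' : Sys} (D : Diagram S T) (E : Diagram T U)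
      (D' : Diagram S' T') (E' : Diagram T' U') :
      Rewrite ((D.comp E).tensor (D'.comp E')) ((D.tensor D').comp (E.tensor E'))
  | associator {S T S' T' S'' T'' : Sys} (D : Diagram S T) (D' : Diagram S' T')
      (D'' : Diagram S'' T'') :
      Rewrite (((D.tensor D').tensor D'').comp (assocWire T T' T''))
        ((assocWire S S' S'').comp (D.tensor (D'.tensor D'')))
  | left_unitor {S T : Sys} (D : Diagram S T) :
      Rewrite (((Diagram.id Sys.unit).tensor D).comp (leftUnitWire T)) ((leftUnitWire S).comp D)
  | right_unitor {S T : Sys} (D : Diagram S T) :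
      Rewrite ((D.tensor (Diagram.id Sys.unit)).comp (rightUnitWire T)) ((rightUnitWire S).comp D)
  | swap {S T S' T' : Sys} (D : Diagram S T) (D' : Diagram S' T') :
      Rewrite ((D.tensor D').comp (swapWire T T')) ((swapWire S S').comp (D'.tensor D))
  -- functions and substochastic maps are embedded with their own composition
  | embed_id (A X : FinSet) :
      Rewrite (embed (fun a : A => a) (SubStoch.id X)) (Diagram.id ⟨A, X⟩)
  | embed_comp {A B C X Y Z : FinSet} (f : A → B) (g : B → C) (s : SubStoch X Y)
      (t : SubStoch Y Z) :
      Rewrite ((embed f s).comp (embed g t)) (embed (fun a => g (f a)) (s.comp t))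
  | embed_tensor {A B X Y A' B' X' Y' : FinSet} (f : A → B) (s : SubStoch X Y)
      (f' : A' → B') (s' : SubStoch X' Y') :
      Rewrite ((embed f s).tensor (embed f' s'))
        (embed (A := A.prod A') (B := B.prod B') (fun a => (f a.1, f' a.2)) (s.tensor s'))
  -- a mechanism is a point state of knowledge about the dynamics
  | embed_eq {A B : FinSet} (f : A → B) :
      Rewrite (embed f (SubStoch.id FinSet.star))
        ((infer A (SubStoch.point (X := A.hom B) f)).comp (prep A B))
  -- states of knowledge about dynamics compose in sequence and in parallel
  | prep_prep (A B C : FinSet) :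
      Rewrite
        (((prep A B).nextTo (B.hom C)).comp
          ((relabel B (FinSet.star.prod (B.hom C)) (B.hom C) fun x => x.2).comp (prep B C)))
        ((relabel A ((A.hom B).prod (B.hom C)) (A.hom C) fun x a => x.2 (x.1 a)).comp (prep A C))
  | prep_tensor (A B A' B' : FinSet) :
      Rewrite
        (((prep A B).tensor (prep A' B')).comp
          (relabel (B.prod B') (FinSet.star.prod FinSet.star) FinSet.star fun x => x.1))
        ((relabel (A.prod A') ((A.hom B).prod (A'.hom B')) ((A.prod A').hom (B.prod B'))
          fun x a => (x.1 a.1, x.2 a.2)).comp (prep (A.prod A') (B.prod B')))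
  -- asking about the tautological proposition is asking nothing
  | know_discard (A : FinSet) :
      Rewrite ((know A).comp (infer A (SubStoch.discard A))) (Diagram.id ⟨A, FinSet.star⟩)
  -- gaining knowledge twice is copying the knowledge
  | know_know (A : FinSet) :
      Rewrite
        ((know A).comp
          ((relabel A A (FinSet.star.prod A) fun x => ((), x)).comp ((know A).nextTo A)))
        ((know A).comp (relabel A A (A.prod A) fun x => (x, x)))
  | know_tensor (A B : FinSet) :
      Rewrite ((know A).tensor (know B))
        ((relabel (A.prod B) (FinSet.star.prod FinSet.star) FinSet.star fun x => x.1).comp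
          (know (A.prod B)))
  -- ignoring a composite system, a trivial system, and the output of a mechanism
  | ignore_tensor (A B : FinSet) :
      Rewrite
        (((ignore A).tensor (ignore B)).comp (rightUnitWire Sys.unit))
        ((relabel (A.prod B) (FinSet.star.prod FinSet.star) FinSet.star fun x => x.1).comp
          (ignore (A.prod B)))
  | ignore_star : Rewrite (ignore FinSet.star) (Diagram.id Sys.unit)
  | prep_ignore (A B : FinSet) :
      Rewrite ((prep A B).comp (ignore B))
        ((infer A (SubStoch.discard (A.hom B))).comp (ignore A))
  -- knowledge about the output of a mechanism comes from knowledge about the input, propagated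
  -- along a copy of what is known about the mechanism
  | prep_know (A B : FinSet) :
      Rewrite
        ((prep A B).comp (know B))
        ((relabel A (A.hom B) (FinSet.star.prod (A.hom B)) fun f => ((), f)).comp
          (((know A).nextTo (A.hom B)).comp
            ((relabel A (A.prod (A.hom B)) ((A.hom B).prod B) fun x => (x.2, x.2 x.1)).comp
              (((prep A B).nextTo B).comp
                (relabel B (FinSet.star.prod B) B fun x => x.2)))))

/-- Diagrams up to the rewrite rules. -/
instance rewriteSetoid (S T : Sys) : Setoid (Diagram S T) where
  r := Rewrite
  iseqv := ⟨Rewrite.refl, Rewrite.symm, Rewrite.trans⟩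

/-- The processes of the theory from `S` to `T`. -/
def CIProc (S T : Sys) : Type 1 := Quotient (rewriteSetoid S T)

namespace CIProc

/-- The process drawn by a diagram. -/
def mk {S T : Sys} (D : Diagram S T) : CIProc S T := Quotient.mk _ D

/-- The identity process. -/
def id (S : Sys) : CIProc S S := mk (Diagram.id S)

/-- Sequential composition, `D` first. -/
def comp {S T U : Sys} (D : CIProc S T) (E : CIProc T U) : CIProc S U :=
  Quotient.map₂ Diagram.comp (fun _ _ h _ _ h' => Rewrite.comp h h') D E

/-- Parallel composition. -/
def tensor {S T S' T' : Sys} (D : CIProc S T) (E : CIProc S' T') :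
    CIProc (S.tensor S') (T.tensor T') :=
  Quotient.map₂ Diagram.tensor (fun _ _ h _ _ h' => Rewrite.tensor h h') D E

/-- The inclusion of substochastic maps. -/
def incl {X Y : FinSet} (s : SubStoch X Y) : CIProc ⟨FinSet.star, X⟩ ⟨FinSet.star, Y⟩ :=
  mk (Diagram.infer FinSet.star s)

/-- The parallel composite of causally closed processes, with the trivial causal wires removed. -/
def closedTensor {X Y X' Y' : FinSet} (D : CIProc ⟨FinSet.star, X⟩ ⟨FinSet.star, Y⟩)
    (E : CIProc ⟨FinSet.star, X'⟩ ⟨FinSet.star, Y'⟩) :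
    CIProc ⟨FinSet.star, X.prod X'⟩ ⟨FinSet.star, Y.prod Y'⟩ :=
  comp (T := ⟨FinSet.star.prod FinSet.star, X.prod X'⟩)
    (mk (Diagram.embed (fun a => (a, a)) (SubStoch.id (X.prod X'))))
    (comp (T := ⟨FinSet.star.prod FinSet.star, Y.prod Y'⟩) (tensor D E)
      (mk (Diagram.embed (fun a => a.1) (SubStoch.id (Y.prod Y')))))

end CIProc

/-- A prediction map: a diagram-preserving map from the causally closed processes to the
substochastic maps which is left inverse to the inclusion of the substochastic maps.
(Identities and swaps of inferential wires are included substochastic maps.) -/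
structure PredictionMap where
  pred : ∀ {X Y : FinSet}, CIProc ⟨FinSet.star, X⟩ ⟨FinSet.star, Y⟩ → SubStoch X Y
  pred_comp : ∀ {X Y Z : FinSet} (D : CIProc ⟨FinSet.star, X⟩ ⟨FinSet.star, Y⟩)
    (E : CIProc ⟨FinSet.star, Y⟩ ⟨FinSet.star, Z⟩), pred (D.comp E) = (pred D).comp (pred E)
  pred_tensor : ∀ {X Y X' Y' : FinSet} (D : CIProc ⟨FinSet.star, X⟩ ⟨FinSet.star, Y⟩)
    (E : CIProc ⟨FinSet.star, X'⟩ ⟨FinSet.star, Y'⟩),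
    pred (D.closedTensor E) = (pred D).tensor (pred E)
  pred_incl : ∀ {X Y : FinSet} (s : SubStoch X Y), pred (CIProc.incl s) = s

/-- A tester for processes from `S` to `T`: a process `before` and a process `after`, joined by
auxiliary wires, into which a process from `S` to `T` is inserted so that
the result is causally closed. -/
structure Tester (S T : Sys) where
  aux : Sys
  inp : FinSet
  out : FinSet
  before : CIProc ⟨FinSet.star, inp⟩ (S.tensor aux)
  after : CIProc (T.tensor aux) ⟨FinSet.star, out⟩

/-- The causally closed process obtained by inserting a process into a tester. -/
def Tester.insert {S T : Sys} (τ : Tester S T) (D : CIProc S T) :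
    CIProc ⟨FinSet.star, τ.inp⟩ ⟨FinSet.star, τ.out⟩ :=
  τ.before.comp ((D.tensor (CIProc.id τ.aux)).comp τ.after)

/-- Inferential equivalence: equal predictions in every tester. -/
def InfEquiv (p : PredictionMap) {S T : Sys} (D E : CIProc S T) : Prop :=
  ∀ τ : Tester S T, p.pred (τ.insert D) = p.pred (τ.insert E)

open Diagram in
/-- Preparing the causal system `A` from an inferential system `A`, through the bijection between
the elements of `A` and the functions from `⋆` to `A`, next to an inferential wire `X`. -/
def prepareInput (A X : FinSet) : CIProc ⟨FinSet.star, X.prod A⟩ ⟨A, X⟩ :=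
  CIProc.mk <|
    (relabel FinSet.star (X.prod A) ((FinSet.star.hom A).prod X) fun x => (fun _ => x.2, x.1)).comp
      (((prep FinSet.star A).nextTo X).comp
        (relabel A (FinSet.star.prod X) X fun x => x.2))

open Diagram in
/-- Gaining knowledge from the causal system `B` and then ignoring `B`, next to
an inferential wire `Y`. -/
def learnOutput (B Y : FinSet) : CIProc ⟨B, Y⟩ ⟨FinSet.star, Y.prod B⟩ :=
  CIProc.mk <|
    (relabel B Y (FinSet.star.prod Y) fun y => ((), y)).comp
      (((know B).nextTo Y).comp
        ((relabel B (B.prod Y) (FinSet.star.prod (Y.prod B)) fun y => ((), (y.2, y.1))).comp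
          (((ignore B).nextTo (Y.prod B)).comp
            (relabel FinSet.star (FinSet.star.prod (Y.prod B)) (Y.prod B) fun y => y.2))))

/-- The substochastic map associated with a process. -/
def assocMap (p : PredictionMap) {S T : Sys} (D : CIProc S T) :
    SubStoch (S.inf.prod S.caus) (T.inf.prod T.caus) :=
  p.pred ((prepareInput S.caus S.inf).comp (D.comp (learnOutput T.caus T.inf)))

/-! ## A prediction map exists -/

namespace Diagram

/-- The kernel computed by a diagram, with causal systems carrying their actual values. -/
def sem : ∀ {S T : Sys}, Diagram S T → SubStoch (S.caus.prod S.inf) (T.caus.prod T.inf)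
  | _, _, embed f s => (SubStoch.det f).tensor s
  | _, _, prep _ _ => SubStoch.det fun x => (x.2 x.1, ())
  | _, _, know _ => SubStoch.det fun x => (x.1, x.1)
  | _, _, ignore _ => SubStoch.det fun _ => ((), ())
  | _, _, id S => SubStoch.id _
  | _, _, comp D E => D.sem.comp E.sem
  | _, _, tensor (S := S) (T := T) (S' := S') (T' := T') D E =>
      { weight := fun x y => D.sem.weight (x.1.1, x.2.1) (y.1.1, y.2.1) *
          E.sem.weight (x.1.2, x.2.2) (y.1.2, y.2.2)
        sum_le := fun x => by
          have h := (D.sem.tensor E.sem).sum_le ((x.1.1, x.2.1), (x.1.2, x.2.2))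
          refine le_trans (le_of_eq ?_) h
          exact Fintype.sum_equiv (Equiv.prodProdProdComm _ _ _ _) _ _ (fun _ => rfl) }

end Diagram

namespace SubStoch

theorem det_comp {X Y Z : FinSet} (f : X → Y) (s : SubStoch Y Z) (x : X) (z : Z) :
    ((det f).comp s).weight x z = s.weight (f x) z := by
  simp [comp, det]

theorem det_comp_det {X Y Z : FinSet} (f : X → Y) (g : Y → Z) :
    (det f).comp (det g) = det fun x => g (f x) := by
  ext x z : 3
  rw [det_comp]
  rfl

theorem comp_assoc {X Y Z W : FinSet} (s : SubStoch X Y) (t : SubStoch Y Z)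
    (u : SubStoch Z W) : (s.comp t).comp u = s.comp (t.comp u) := by
  ext x w : 3
  simp only [comp, Finset.sum_mul, Finset.mul_sum, mul_assoc]
  rw [Finset.sum_comm]

theorem id_comp {X Y : FinSet} (s : SubStoch X Y) : (id X).comp s = s := by
  ext x y : 3
  simp [comp, id, det]

theorem comp_id {X Y : FinSet} (s : SubStoch X Y) : s.comp (id Y) = s := by
  ext x y : 3
  simp [comp, id, det]

theorem comp_det_equiv {X Y Z : FinSet} (s : SubStoch X Y) (f : Y → Z) (g : Z → Y)
    (hfg : ∀ z, f (g z) = z) (hgf : ∀ y, g (f y) = y) (x : X) (z : Z) :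
    (s.comp (det f)).weight x z = s.weight x (g z) := by
  simp only [comp, det, mul_ite, mul_one, mul_zero]
  rw [Finset.sum_eq_single (g z)]
  · simp [hfg]
  · intro b _ hb
    rw [if_neg]
    rintro rfl
    exact hb (hgf b).symm
  · simp

theorem det_tensor_det {X Y X' Y' : FinSet} (f : X → Y) (f' : X' → Y') :
    (det f).tensor (det f') =
      det (X := X.prod X') (Y := Y.prod Y') fun x => (f x.1, f' x.2) := by
  ext x y : 3
  simp only [tensor, det, Prod.ext_iff]
  split_ifs <;> simp_all

theorem tensor_comp {X Y Z X' Y' Z' : FinSet} (s : SubStoch X Y) (t : SubStoch Y Z)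
    (s' : SubStoch X' Y') (t' : SubStoch Y' Z') :
    (s.tensor s').comp (t.tensor t') = (s.comp t).tensor (s'.comp t') := by
  ext x z : 3
  refine (Fintype.sum_prod_type _).trans (Eq.trans ?_ (Finset.sum_mul_sum _ _ _ _).symm)
  refine Finset.sum_congr rfl fun _ _ => Finset.sum_congr rfl fun _ _ => ?_
  exact mul_mul_mul_comm _ _ _ _

end SubStoch

namespace Diagram

/-- The diagram computes the function `F`. -/
def IsDet {S T : Sys} (D : Diagram S T) (F : S.caus.prod S.inf → T.caus.prod T.inf) : Prop :=
  D.sem = SubStoch.det F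

theorem isDet_embed {A B X Y : FinSet} (f : A → B) (g : X → Y) :
    IsDet (embed f (SubStoch.det g)) fun x => (f x.1, g x.2) :=
  SubStoch.det_tensor_det f g

theorem sem_wire {A B X Y : FinSet} (f : A → B) (g : X → Y) :
    (embed f (SubStoch.det g)).sem =
      SubStoch.det (X := A.prod X) (Y := B.prod Y) fun x => (f x.1, g x.2) :=
  SubStoch.det_tensor_det f g

theorem sem_comp {S T U : Sys} (D : Diagram S T) (E : Diagram T U) :
    (D.comp E).sem = D.sem.comp E.sem := by
  rw [sem]

theorem sem_comp_wire {S : Sys} {B C Y Z : FinSet} (D : Diagram S ⟨B, Y⟩) (f : B → C)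
    (g : Y → Z) (f' : C → B) (g' : Z → Y) (hf : ∀ c, f (f' c) = c) (hf' : ∀ b, f' (f b) = b)
    (hg : ∀ z, g (g' z) = z) (hg' : ∀ y, g' (g y) = y) (x : S.caus.prod S.inf) (z : C.prod Z) :
    (D.comp (embed f (SubStoch.det g))).sem.weight x z = D.sem.weight x (f' z.1, g' z.2) := by
  rw [sem_comp, sem_wire, SubStoch.comp_det_equiv _ _ (fun z : C.prod Z => (f' z.1, g' z.2))
    (fun z => by simp [hf, hg]) (fun y => by simp [hf', hg'])]

theorem sem_wire_comp {T : Sys} {A B X Y : FinSet} (f : A → B) (g : X → Y)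
    (D : Diagram ⟨B, Y⟩ T) (x : A.prod X) (z : T.caus.prod T.inf) :
    ((embed f (SubStoch.det g)).comp D).sem.weight x z = D.sem.weight (f x.1, g x.2) z := by
  rw [sem_comp, sem_wire, SubStoch.det_comp]

theorem isDet_comp {S T U : Sys} {D : Diagram S T} {E : Diagram T U} {F G} (hD : IsDet D F)
    (hE : IsDet E G) : IsDet (D.comp E) fun x => G (F x) := by
  unfold IsDet at *
  rw [sem, hD, hE, SubStoch.det_comp_det]

theorem isDet_tensor {S T S' T' : Sys} {D : Diagram S T} {E : Diagram S' T'} {F G}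
    (hD : IsDet D F) (hE : IsDet E G) : IsDet (D.tensor E) fun x =>
      (((F (x.1.1, x.2.1)).1, (G (x.1.2, x.2.2)).1),
        ((F (x.1.1, x.2.1)).2, (G (x.1.2, x.2.2)).2)) := by
  unfold IsDet at *
  ext x y : 3
  simp only [sem, hD, hE, SubStoch.det, Prod.ext_iff]
  split_ifs <;> simp_all

theorem isDet_id (S : Sys) : IsDet (Diagram.id S) fun x => x := rfl

theorem isDet_prep (A B : FinSet) : IsDet (prep A B) fun x => (x.2 x.1, ()) := rfl

theorem isDet_know (A : FinSet) : IsDet (know A) fun x => (x.1, x.1) := rfl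

theorem isDet_ignore (A : FinSet) : IsDet (ignore A) fun _ => ((), ()) := rfl

theorem isDet_nextTo {A B X Y : FinSet} {D : Diagram ⟨A, X⟩ ⟨B, Y⟩} {F} (hD : IsDet D F)
    (Z : FinSet) : IsDet (D.nextTo Z) fun x =>
      ((F (x.1, x.2.1)).1, ((F (x.1, x.2.1)).2, x.2.2)) :=
  isDet_comp (D := embed (B := A.prod FinSet.star) (fun a => (a, ())) (SubStoch.id (X.prod Z)))
    (isDet_embed _ _)
    (isDet_comp (D := D.tensor (Diagram.id ⟨FinSet.star, Z⟩)) (isDet_tensor hD (isDet_id _))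
      (isDet_embed (A := B.prod FinSet.star) _ _))

theorem sem_eq_of_isDet {S T : Sys} {D E : Diagram S T} {F G} (hD : IsDet D F)
    (hE : IsDet E G) (h : ∀ x, F x = G x) : D.sem = E.sem := by
  obtain rfl : F = G := funext h
  exact hD.trans (Eq.symm hE)

theorem sem_tensor_weight {S T S' T' : Sys} (D : Diagram S T) (E : Diagram S' T') (x y) :
    (D.tensor E).sem.weight x y = D.sem.weight (x.1.1, x.2.1) (y.1.1, y.2.1) *
      E.sem.weight (x.1.2, x.2.2) (y.1.2, y.2.2) := by
  rw [sem]

end Diagram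

open Diagram in
theorem Rewrite.sem_eq {S T : Sys} {D E : Diagram S T} (h : Rewrite D E) : D.sem = E.sem := by
  induction h with
  | refl => rfl
  | symm _ ih => exact ih.symm
  | trans _ _ ih ih' => exact ih.trans ih'
  | comp _ _ ih ih' => simp only [sem, ih, ih']
  | tensor _ _ ih ih' => simp only [sem, ih, ih']
  | id_comp => exact SubStoch.id_comp _
  | comp_id => exact SubStoch.comp_id _
  | assoc => exact SubStoch.comp_assoc _ _ _
  | id_tensor => exact isDet_tensor (isDet_id _) (isDet_id _)
  | interchange D E D' E' =>
    ext x z : 3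
    have h := congrArg (fun s => SubStoch.weight s ((x.1.1, x.2.1), (x.1.2, x.2.2))
      ((z.1.1, z.2.1), (z.1.2, z.2.2))) (SubStoch.tensor_comp D.sem E.sem D'.sem E'.sem)
    rw [sem_tensor_weight]
    refine Eq.trans (b := _) (Eq.symm h) ?_
    exact Fintype.sum_equiv (Equiv.prodProdProdComm _ _ _ _) _ _ (fun _ => rfl)
  | @associator S T S' T' S'' T'' D D' D'' =>
    ext x y : 3
    refine (sem_comp_wire ((D.tensor D').tensor D'') _ _
      (fun z : T.caus × T'.caus × T''.caus => ((z.1, z.2.1), z.2.2))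
      (fun z : T.inf × T'.inf × T''.inf => ((z.1, z.2.1), z.2.2)) (fun _ => rfl)
      (fun _ => rfl) (fun _ => rfl) (fun _ => rfl) x y).trans
        (Eq.trans ?_ (sem_wire_comp _ _ _ x y).symm)
    simp only [sem_tensor_weight, mul_assoc]
  | left_unitor D =>
    ext x y : 3
    refine (sem_comp_wire ((Diagram.id Sys.unit).tensor D) _ _ (fun z => ((), z))
      (fun z => ((), z)) (fun _ => rfl)
      (fun _ => rfl) (fun _ => rfl) (fun _ => rfl) x y).trans
        (Eq.trans ?_ (sem_wire_comp _ _ _ x y).symm)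
    rw [sem_tensor_weight, sem]
    simp [SubStoch.id, SubStoch.det]
  | right_unitor D =>
    ext x y : 3
    refine (sem_comp_wire (D.tensor (Diagram.id Sys.unit)) _ _ (fun z => (z, ()))
      (fun z => (z, ())) (fun _ => rfl)
      (fun _ => rfl) (fun _ => rfl) (fun _ => rfl) x y).trans
        (Eq.trans ?_ (sem_wire_comp _ _ _ x y).symm)
    rw [sem_tensor_weight, sem]
    simp [SubStoch.id, SubStoch.det]
  | @swap S T S' T' D D' =>
    ext x y : 3
    refine (sem_comp_wire (D.tensor D') _ _ (fun z : T'.caus × T.caus => (z.2, z.1))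
      (fun z : T'.inf × T.inf => (z.2, z.1)) (fun _ => rfl)
      (fun _ => rfl) (fun _ => rfl) (fun _ => rfl) x y).trans
        (Eq.trans ?_ (sem_wire_comp _ _ _ x y).symm)
    simp only [sem_tensor_weight, mul_comm]
  | embed_id => exact isDet_embed _ _
  | embed_comp f g s t =>
    simp only [sem, SubStoch.tensor_comp, SubStoch.det_comp_det]
  | embed_tensor f s f' s' =>
    ext x y : 3
    rw [sem_tensor_weight]
    simp only [sem, SubStoch.tensor, SubStoch.det, Prod.ext_iff]
    split_ifs <;> simp_all
  | embed_eq f =>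
    exact sem_eq_of_isDet (isDet_embed _ _)
      (isDet_comp (isDet_embed _ _) (isDet_prep _ _)) fun _ => rfl
  | prep_prep =>
    exact sem_eq_of_isDet
      (isDet_comp (isDet_nextTo (isDet_prep _ _) _)
        (isDet_comp (isDet_embed _ _) (isDet_prep _ _)))
      (isDet_comp (isDet_embed _ _) (isDet_prep _ _)) fun _ => rfl
  | prep_tensor =>
    exact sem_eq_of_isDet
      (isDet_comp (isDet_tensor (isDet_prep _ _) (isDet_prep _ _)) (isDet_embed _ _))
      (isDet_comp (isDet_embed _ _) (isDet_prep _ _)) fun _ => rfl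
  | know_discard =>
    exact sem_eq_of_isDet (isDet_comp (isDet_know _) (isDet_embed _ _)) (isDet_id _) fun _ => rfl
  | know_know =>
    exact sem_eq_of_isDet
      (isDet_comp (isDet_know _)
        (isDet_comp (isDet_embed _ _) (isDet_nextTo (isDet_know _) _)))
      (isDet_comp (isDet_know _) (isDet_embed _ _)) fun _ => rfl
  | know_tensor =>
    exact sem_eq_of_isDet (isDet_tensor (isDet_know _) (isDet_know _))
      (isDet_comp (isDet_embed _ _) (isDet_know _)) fun _ => rfl
  | ignore_tensor =>
    exact sem_eq_of_isDet
      (isDet_comp (isDet_tensor (isDet_ignore _) (isDet_ignore _)) (isDet_embed _ _))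
      (isDet_comp (isDet_embed _ _) (isDet_ignore _)) fun _ => rfl
  | ignore_star => exact sem_eq_of_isDet (isDet_ignore _) (isDet_id _) fun _ => rfl
  | prep_ignore =>
    exact sem_eq_of_isDet (isDet_comp (isDet_prep _ _) (isDet_ignore _))
      (isDet_comp (isDet_embed _ _) (isDet_ignore _)) fun _ => rfl
  | prep_know =>
    exact sem_eq_of_isDet (isDet_comp (isDet_prep _ _) (isDet_know _))
      (isDet_comp (isDet_embed _ _) (isDet_comp (isDet_nextTo (isDet_know _) _)
        (isDet_comp (isDet_embed _ _) (isDet_comp (isDet_nextTo (isDet_prep _ _) _)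
          (isDet_embed _ _))))) fun _ => rfl

/-- The kernel computed by a process. -/
def CIProc.sem {S T : Sys} (D : CIProc S T) :
    SubStoch (S.caus.prod S.inf) (T.caus.prod T.inf) :=
  Quotient.lift Diagram.sem (fun _ _ h => Rewrite.sem_eq h) D

/-- The prediction map that evaluates the kernel of a causally closed process. -/
def evalPrediction : PredictionMap where
  pred D :=
    { weight := fun x y => D.sem.weight ((), x) ((), y)
      sum_le := fun x => by
        refine le_trans (le_of_eq ?_) (D.sem.sum_le ((), x))
        rw [Fintype.sum_prod_type]
        simp }
  pred_comp D E := by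
    induction D using Quotient.inductionOn with | h D => ?_
    induction E using Quotient.inductionOn with | h E => ?_
    ext x z : 3
    exact (Fintype.sum_prod_type _).trans (Fintype.sum_unique _)
  pred_tensor {X Y X' Y'} D E := by
    induction D using Quotient.inductionOn with | h D => ?_
    induction E using Quotient.inductionOn with | h E => ?_
    ext x y : 3
    refine Eq.trans ?_ (Diagram.sem_tensor_weight D E (((), ()), x) (((), ()), y))
    let G : Diagram ⟨FinSet.star.prod FinSet.star, Y.prod Y'⟩ ⟨FinSet.star, Y.prod Y'⟩ :=
      Diagram.embed (fun a => a.1) (SubStoch.id (Y.prod Y'))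
    exact (Diagram.sem_wire_comp (A := FinSet.star) (B := FinSet.star.prod FinSet.star)
      (fun a => (a, a)) (fun x => x) ((D.tensor E).comp G) ((), x) ((), y)).trans
      (Diagram.sem_comp_wire (C := FinSet.star) (D.tensor E) (fun a => a.1) (fun y => y)
        (fun _ => ((), ())) (fun z => z) (fun _ => rfl) (fun _ => rfl) (fun _ => rfl)
        (fun _ => rfl) (((), ()), x) ((), y))
  pred_incl s := by
    ext x y : 3
    change (if () = () then (1 : ℝ≥0) else 0) * s.weight x y = s.weight x y
    simp

instance : Nonempty PredictionMap := ⟨evalPrediction⟩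

namespace CIProc

/-- A function on the causal wires next to a substochastic map on the inferential wires. -/
def emb {A B X Y : FinSet} (f : A → B) (s : SubStoch X Y) : CIProc ⟨A, X⟩ ⟨B, Y⟩ :=
  mk (Diagram.embed f s)

/-- A function on the causal wires next to a function on the inferential wires. -/
def wire {A B X Y : FinSet} (f : A → B) (g : X → Y) : CIProc ⟨A, X⟩ ⟨B, Y⟩ :=
  emb f (SubStoch.det g)

/-- A function on the inferential wires. -/
def rewire (A X Y : FinSet) (g : X → Y) : CIProc ⟨A, X⟩ ⟨A, Y⟩ :=
  wire (fun a => a) g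

/-- The process `D` next to an inferential wire `Z`. -/
def side {A B X Y : FinSet} (D : CIProc ⟨A, X⟩ ⟨B, Y⟩) (Z : FinSet) :
    CIProc ⟨A, X.prod Z⟩ ⟨B, Y.prod Z⟩ :=
  comp (T := ⟨A.prod FinSet.star, X.prod Z⟩) (wire (fun a => (a, ())) fun x => x)
    (comp (T := ⟨B.prod FinSet.star, Y.prod Z⟩) (tensor D (id ⟨FinSet.star, Z⟩))
      (wire (fun b => b.1) fun x => x))

theorem comp_assoc {S T U V : Sys} (D : CIProc S T) (E : CIProc T U) (F : CIProc U V) :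
    (D.comp E).comp F = D.comp (E.comp F) := by
  induction D using Quotient.inductionOn
  induction E using Quotient.inductionOn
  induction F using Quotient.inductionOn
  exact Quotient.sound (Rewrite.assoc _ _ _)

theorem id_comp {S T : Sys} (D : CIProc S T) : (id S).comp D = D := by
  induction D using Quotient.inductionOn
  exact Quotient.sound (Rewrite.id_comp _)

theorem comp_id {S T : Sys} (D : CIProc S T) : D.comp (id T) = D := by
  induction D using Quotient.inductionOn
  exact Quotient.sound (Rewrite.comp_id _)

theorem id_tensor (S T : Sys) : (id S).tensor (id T) = id (S.tensor T) :=
  Quotient.sound (Rewrite.id_tensor _ _)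

theorem comp_tensor_comp {S T U S' T' U' : Sys} (D : CIProc S T) (E : CIProc T U)
    (D' : CIProc S' T') (E' : CIProc T' U') :
    (D.comp E).tensor (D'.comp E') = (D.tensor D').comp (E.tensor E') := by
  induction D using Quotient.inductionOn
  induction E using Quotient.inductionOn
  induction D' using Quotient.inductionOn
  induction E' using Quotient.inductionOn
  exact Quotient.sound (Rewrite.interchange _ _ _ _)

theorem emb_id (A X : FinSet) : emb (fun a : A => a) (SubStoch.id X) = id ⟨A, X⟩ :=
  Quotient.sound (Rewrite.embed_id _ _)

theorem wire_id (A X : FinSet) : wire (fun a : A => a) (fun x : X => x) = id ⟨A, X⟩ :=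
  emb_id A X

theorem emb_comp {A B C X Y Z : FinSet} (f : A → B) (g : B → C) (s : SubStoch X Y)
    (t : SubStoch Y Z) : (emb f s).comp (emb g t) = emb (fun a => g (f a)) (s.comp t) :=
  Quotient.sound (Rewrite.embed_comp _ _ _ _)

theorem wire_comp {A B C X Y Z : FinSet} (f : A → B) (g : B → C) (s : X → Y)
    (t : Y → Z) : (wire f s).comp (wire g t) = wire (fun a => g (f a)) fun x => t (s x) :=
  (emb_comp f g _ _).trans (by rw [SubStoch.det_comp_det]; rfl)

theorem wire_comp_assoc {A B C X Y Z : FinSet} {T : Sys} (f : A → B) (g : B → C) (s : X → Y)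
    (t : Y → Z) (D : CIProc ⟨C, Z⟩ T) : (wire f s).comp ((wire g t).comp D) =
      (wire (fun a => g (f a)) fun x => t (s x)).comp D := by
  rw [← comp_assoc, wire_comp]

theorem emb_tensor {A B X Y A' B' X' Y' : FinSet} (f : A → B) (s : SubStoch X Y)
    (f' : A' → B') (s' : SubStoch X' Y') : (emb f s).tensor (emb f' s') =
      emb (A := A.prod A') (B := B.prod B') (fun a => (f a.1, f' a.2)) (s.tensor s') :=
  Quotient.sound (Rewrite.embed_tensor _ _ _ _)

theorem wire_tensor {A B X Y A' B' X' Y' : FinSet} (f : A → B) (g : X → Y)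
    (f' : A' → B') (g' : X' → Y') : (wire f g).tensor (wire f' g') =
      wire (A := A.prod A') (B := B.prod B') (X := X.prod X') (Y := Y.prod Y')
        (fun a => (f a.1, f' a.2)) (fun x => (g x.1, g' x.2)) :=
  (emb_tensor f _ f' _).trans (by rw [SubStoch.det_tensor_det]; rfl)

theorem associator {S T S' T' S'' T'' : Sys} (D : CIProc S T) (D' : CIProc S' T')
    (D'' : CIProc S'' T'') :
    ((D.tensor D').tensor D'').comp (mk (Diagram.assocWire T T' T'')) =
      (mk (Diagram.assocWire S S' S'')).comp (D.tensor (D'.tensor D'')) := by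
  induction D using Quotient.inductionOn
  induction D' using Quotient.inductionOn
  induction D'' using Quotient.inductionOn
  exact Quotient.sound (Rewrite.associator _ _ _)

theorem swap {S T S' T' : Sys} (D : CIProc S T) (D' : CIProc S' T') :
    (D.tensor D').comp (mk (Diagram.swapWire T T')) =
      (mk (Diagram.swapWire S S')).comp (D'.tensor D) := by
  induction D using Quotient.inductionOn
  induction D' using Quotient.inductionOn
  exact Quotient.sound (Rewrite.swap _ _)

theorem right_unitor {S T : Sys} (D : CIProc S T) :
    (D.tensor (id Sys.unit)).comp (mk (Diagram.rightUnitWire T)) =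
      (mk (Diagram.rightUnitWire S)).comp D := by
  induction D using Quotient.inductionOn
  exact Quotient.sound (Rewrite.right_unitor _)

theorem rewire_comp {A X Y Z : FinSet} (g : X → Y) (h : Y → Z) :
    (rewire A X Y g).comp (rewire A Y Z h) = rewire A X Z fun x => h (g x) :=
  wire_comp _ _ _ _

theorem rewire_comp_assoc {A X Y Z : FinSet} {T : Sys} (g : X → Y) (h : Y → Z)
    (D : CIProc ⟨A, Z⟩ T) : (rewire A X Y g).comp ((rewire A Y Z h).comp D) =
      (rewire A X Z fun x => h (g x)).comp D :=
  wire_comp_assoc _ _ _ _ _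

theorem rewire_id (A X : FinSet) : (rewire A X X fun x => x) = id ⟨A, X⟩ :=
  wire_id A X

theorem tensor_eq {S T S' T' : Sys} (D : CIProc S T) (E : CIProc S' T') :
    D.tensor E = (D.tensor (id S')).comp ((id T).tensor E) := by
  rw [← comp_tensor_comp, comp_id, id_comp]

theorem comp_tensor_id {S T U : Sys} (D : CIProc S T) (E : CIProc T U) (V : Sys) :
    (D.comp E).tensor (id V) = (D.tensor (id V)).comp (E.tensor (id V)) := by
  rw [← comp_tensor_comp, comp_id]

theorem side_comp {A B C X Y Z : FinSet} (D : CIProc ⟨A, X⟩ ⟨B, Y⟩) (E : CIProc ⟨B, Y⟩ ⟨C, Z⟩)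
    (W : FinSet) : side (D.comp E) W = (side D W).comp (side E W) := by
  unfold side
  rw [comp_tensor_id]
  simp only [comp_assoc]
  rw [wire_comp_assoc]
  have h := wire_id (B.prod FinSet.star) (Y.prod W)
  erw [h, id_comp]

theorem side_emb {A B X Y : FinSet} (f : A → B) (s : SubStoch X Y) (Z : FinSet) :
    side (emb f s) Z = emb f (s.tensor (SubStoch.id Z)) := by
  unfold side
  rw [← emb_id, emb_tensor]
  unfold wire
  rw [emb_comp, emb_comp]
  congr 1
  exact (SubStoch.id_comp _).trans (SubStoch.comp_id _)

theorem side_rewire {A X Y : FinSet} (g : X → Y) (Z : FinSet) :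
    side (rewire A X Y g) Z = rewire A (X.prod Z) (Y.prod Z) fun x => (g x.1, x.2) :=
  (side_emb _ _ _).trans (by unfold SubStoch.id; rw [SubStoch.det_tensor_det]; rfl)

theorem side_natural {A B X Y Z Z' : FinSet} (D : CIProc ⟨A, X⟩ ⟨B, Y⟩) (s : SubStoch Z Z') :
    (side D Z).comp (emb (fun b => b) ((SubStoch.id Y).tensor s)) =
      (emb (fun a => a) ((SubStoch.id X).tensor s)).comp (side D Z') := by
  have h : (D.tensor (id ⟨FinSet.star, Z⟩)).comp
        ((id ⟨B, Y⟩).tensor (emb (fun a => a) s)) =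
      ((id ⟨A, X⟩).tensor (emb (fun a => a) s)).comp (D.tensor (id ⟨FinSet.star, Z'⟩)) := by
    rw [← comp_tensor_comp, ← comp_tensor_comp, comp_id, comp_id, id_comp, id_comp]
  rw [← emb_id B Y, ← emb_id A X, emb_tensor, emb_tensor] at h
  unfold side
  have h1 : (wire (A := B.prod FinSet.star) (X := Y.prod Z) (fun b => b.1) fun x => x).comp
      (emb (fun b => b) ((SubStoch.id Y).tensor s)) =
      (emb (A := B.prod FinSet.star) (fun b => b) ((SubStoch.id Y).tensor s)).comp
        (wire (A := B.prod FinSet.star) (X := Y.prod Z') (fun b => b.1) fun x => x) := by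
    unfold wire
    rw [emb_comp, emb_comp]
    congr 1
    exact (SubStoch.id_comp _).trans (SubStoch.comp_id _).symm
  have h2 : (wire (B := A.prod FinSet.star) (X := X.prod Z) (fun b => (b, ())) fun x => x).comp
      (emb (fun b => b) ((SubStoch.id X).tensor s)) =
      (emb (fun b => b) ((SubStoch.id X).tensor s)).comp
        (wire (B := A.prod FinSet.star) (X := X.prod Z') (fun b => (b, ())) fun x => x) := by
    unfold wire
    rw [emb_comp, emb_comp]
    congr 1
    exact (SubStoch.id_comp _).trans (SubStoch.comp_id _).symm
  rw [comp_assoc, comp_assoc, h1, ← comp_assoc (emb _ _), ← h2, comp_assoc]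
  congr 1
  rw [← comp_assoc, ← comp_assoc]
  congr 1

theorem tensor_tensor {S T S' T' S'' T'' : Sys} (D : CIProc S T) (D' : CIProc S' T')
    (D'' : CIProc S'' T'') : (D.tensor D').tensor D'' =
      (mk (Diagram.assocWire S S' S'')).comp ((D.tensor (D'.tensor D'')).comp
        (wire (A := T.caus.prod (T'.caus.prod T''.caus)) (B := (T.caus.prod T'.caus).prod T''.caus)
          (X := T.inf.prod (T'.inf.prod T''.inf)) (Y := (T.inf.prod T'.inf).prod T''.inf)
          (fun a => ((a.1, a.2.1), a.2.2)) (fun x => ((x.1, x.2.1), x.2.2)))) := by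
  rw [← comp_assoc, ← associator, comp_assoc]
  have h : (mk (Diagram.assocWire T T' T'')).comp
      (wire (A := T.caus.prod (T'.caus.prod T''.caus)) (B := (T.caus.prod T'.caus).prod T''.caus)
        (X := T.inf.prod (T'.inf.prod T''.inf)) (Y := (T.inf.prod T'.inf).prod T''.inf)
        (fun a => ((a.1, a.2.1), a.2.2)) (fun x => ((x.1, x.2.1), x.2.2))) = id _ :=
    (wire_comp _ _ _ _).trans (wire_id _ _)
  rw [h, comp_id]

theorem id_star_tensor (Z W : FinSet) :
    (id ⟨FinSet.star, Z⟩).tensor (id ⟨FinSet.star, W⟩) =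
      (wire (A := FinSet.star.prod FinSet.star) (B := FinSet.star) (X := Z.prod W) (Y := Z.prod W)
        (fun _ => ()) (fun x => x)).comp ((id ⟨FinSet.star, Z.prod W⟩).comp
        (wire (A := FinSet.star) (B := FinSet.star.prod FinSet.star) (X := Z.prod W)
          (Y := Z.prod W) (fun _ => ((), ())) (fun x => x))) := by
  rw [id_comp, wire_comp, id_tensor]
  exact (wire_id _ _).symm

theorem wire_tensor_id {A B X Y : FinSet} (f : A → B) (g : X → Y) (C W : FinSet) :
    (wire f g).tensor (id ⟨C, W⟩) = wire (A := A.prod C) (B := B.prod C) (X := X.prod W)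
      (Y := Y.prod W) (fun a => (f a.1, a.2)) (fun x => (g x.1, x.2)) := by
  rw [← wire_id, wire_tensor]

theorem id_tensor_wire {A B X Y : FinSet} (f : A → B) (g : X → Y) (C W : FinSet) :
    (id ⟨C, W⟩).tensor (wire f g) = wire (A := C.prod A) (B := C.prod B) (X := W.prod X)
      (Y := W.prod Y) (fun a => (a.1, f a.2)) (fun x => (x.1, g x.2)) := by
  rw [← wire_id, wire_tensor]

theorem tensor_id_id {A B X Y : FinSet} (D : CIProc ⟨A, X⟩ ⟨B, Y⟩) (Z W : FinSet) :
    (D.tensor (id ⟨FinSet.star, Z⟩)).tensor (id ⟨FinSet.star, W⟩) =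
      (wire (A := (A.prod FinSet.star).prod FinSet.star) (B := A.prod FinSet.star)
        (X := (X.prod Z).prod W) (Y := X.prod (Z.prod W)) (fun a => (a.1.1, ()))
        (fun x => (x.1.1, (x.1.2, x.2)))).comp ((D.tensor (id ⟨FinSet.star, Z.prod W⟩)).comp
      (wire (A := B.prod FinSet.star) (B := (B.prod FinSet.star).prod FinSet.star)
        (X := Y.prod (Z.prod W)) (Y := (Y.prod Z).prod W) (fun a => ((a.1, ()), ()))
        (fun x => ((x.1, x.2.1), x.2.2)))) := by
  rw [tensor_tensor, id_star_tensor]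
  have h : D.tensor ((wire (A := FinSet.star.prod FinSet.star) (B := FinSet.star) (X := Z.prod W)
        (Y := Z.prod W) (fun _ => ()) (fun x => x)).comp ((id ⟨FinSet.star, Z.prod W⟩).comp
        (wire (A := FinSet.star) (B := FinSet.star.prod FinSet.star) (X := Z.prod W)
          (Y := Z.prod W) (fun _ => ((), ())) (fun x => x)))) =
      (((id _).tensor (wire (A := FinSet.star.prod FinSet.star) (B := FinSet.star) (X := Z.prod W)
        (Y := Z.prod W) (fun _ => ()) (fun x => x))).comp
        ((D.tensor (id ⟨FinSet.star, Z.prod W⟩)).comp ((id _).tensor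
        (wire (A := FinSet.star) (B := FinSet.star.prod FinSet.star) (X := Z.prod W)
          (Y := Z.prod W) (fun _ => ((), ())) (fun x => x))))) := by
    simp only [← comp_tensor_comp, id_comp, comp_id]
  erw [h]
  rw [id_tensor_wire, id_tensor_wire]
  simp only [comp_assoc]
  erw [wire_comp]
  rw [← comp_assoc]
  congr 1
  exact wire_comp _ _ _ _

theorem side_side {A B X Y : FinSet} (D : CIProc ⟨A, X⟩ ⟨B, Y⟩) (Z W : FinSet) :
    side (side D Z) W =
      (rewire A ((X.prod Z).prod W) (X.prod (Z.prod W)) fun x => (x.1.1, (x.1.2, x.2))).comp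
        ((side D (Z.prod W)).comp
          (rewire B (Y.prod (Z.prod W)) ((Y.prod Z).prod W) fun x => ((x.1, x.2.1), x.2.2))) := by
  unfold side
  rw [comp_tensor_id, comp_tensor_id, tensor_id_id, wire_tensor_id, wire_tensor_id]
  unfold rewire
  simp only [comp_assoc, wire_comp_assoc, wire_comp]

/-- Gaining knowledge from the causal system `A`, next to an inferential wire `X`. -/
def learn (A X : FinSet) : CIProc ⟨A, X⟩ ⟨A, A.prod X⟩ :=
  (rewire A X (FinSet.star.prod X) fun x => ((), x)).comp (side (mk (Diagram.know A)) X)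

/-- Applying a function read from an inferential wire to the causal system `A`, next to
an inferential wire `Y`. -/
def apply (A B Y : FinSet) : CIProc ⟨A, (A.hom B).prod Y⟩ ⟨B, Y⟩ :=
  (side (mk (Diagram.prep A B)) Y).comp (rewire B (FinSet.star.prod Y) Y fun y => y.2)

theorem side_know (A X : FinSet) : side (mk (Diagram.know A)) X =
    (rewire A (FinSet.star.prod X) X fun x => x.2).comp (learn A X) := by
  unfold learn
  rw [rewire_comp_assoc]
  exact ((congrArg (fun D => comp D _) (rewire_id _ _)).trans (id_comp _)).symm

theorem side_prep (A B Y : FinSet) : side (mk (Diagram.prep A B)) Y =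
    (apply A B Y).comp (rewire B Y (FinSet.star.prod Y) fun y => ((), y)) := by
  unfold apply
  rw [comp_assoc, rewire_comp]
  exact ((congrArg (fun D => comp _ D) (rewire_id _ _)).trans (comp_id _)).symm

theorem emb_comp_learn (A : FinSet) {X Y : FinSet} (s : SubStoch X Y) :
    (emb (fun a : A => a) s).comp (learn A Y) =
      (learn A X).comp (emb (fun a => a) ((SubStoch.id A).tensor s)) := by
  unfold learn
  rw [comp_assoc, side_natural, ← comp_assoc, ← comp_assoc]
  congr 1
  unfold rewire wire
  rw [emb_comp, emb_comp]
  congr 1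
  ext x y : 3
  rw [SubStoch.det_comp, SubStoch.comp_det_equiv _ _ (fun y : FinSet.star.prod Y => y.2)
    (fun _ => rfl) (fun _ => rfl)]
  simp [SubStoch.tensor, SubStoch.id, SubStoch.det]

theorem apply_comp_emb (A B : FinSet) {X Y : FinSet} (s : SubStoch X Y) :
    (apply A B X).comp (emb (fun a => a) s) =
      (emb (fun a => a) ((SubStoch.id (A.hom B)).tensor s)).comp (apply A B Y) := by
  unfold apply
  rw [← comp_assoc (emb _ _), ← side_natural, comp_assoc, comp_assoc]
  congr 1
  unfold rewire wire
  rw [emb_comp, emb_comp]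
  congr 1
  ext x y : 3
  rw [SubStoch.det_comp, SubStoch.comp_det_equiv _ _ (fun y => ((), y)) (fun _ => rfl)
    (fun _ => rfl)]
  simp [SubStoch.tensor, SubStoch.id, SubStoch.det]

theorem know_know (A : FinSet) : (mk (Diagram.know A)).comp
    ((rewire A A (FinSet.star.prod A) fun x => ((), x)).comp (side (mk (Diagram.know A)) A)) =
      (mk (Diagram.know A)).comp (rewire A A (A.prod A) fun x => (x, x)) :=
  Quotient.sound (Rewrite.know_know A)

theorem know_discard (A : FinSet) : (mk (Diagram.know A)).comp
    (rewire A A FinSet.star fun _ => ()) = id ⟨A, FinSet.star⟩ :=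
  Quotient.sound (Rewrite.know_discard A)

theorem prep_prep (A B C : FinSet) : (side (mk (Diagram.prep A B)) (B.hom C)).comp
    ((rewire B (FinSet.star.prod (B.hom C)) (B.hom C) fun x => x.2).comp
      (mk (Diagram.prep B C))) =
    (rewire A ((A.hom B).prod (B.hom C)) (A.hom C) fun x a => x.2 (x.1 a)).comp
      (mk (Diagram.prep A C)) :=
  Quotient.sound (Rewrite.prep_prep A B C)

theorem prep_know (A B : FinSet) : (mk (Diagram.prep A B)).comp (mk (Diagram.know B)) =
    (rewire A (A.hom B) (FinSet.star.prod (A.hom B)) fun f => ((), f)).comp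
      ((side (mk (Diagram.know A)) (A.hom B)).comp
        ((rewire A (A.prod (A.hom B)) ((A.hom B).prod B) fun x => (x.2, x.2 x.1)).comp
          ((side (mk (Diagram.prep A B)) B).comp
            (rewire B (FinSet.star.prod B) B fun x => x.2)))) :=
  Quotient.sound (Rewrite.prep_know A B)

theorem learn_comp_learn (A X : FinSet) : (learn A X).comp (learn A (A.prod X)) =
    (learn A X).comp (rewire A (A.prod X) (A.prod (A.prod X)) fun x => (x.1, x)) := by
  have h := congrArg (fun D => side D X) (know_know A)
  simp only [side_comp, side_side, side_rewire] at h
  have h' := congrArg (fun D => (rewire A X (FinSet.star.prod X) fun x => ((), x)).comp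
    (D.comp (rewire A ((A.prod A).prod X) (A.prod (A.prod X)) fun x => (x.1.1, (x.1.2, x.2))))) h
  simp only [comp_assoc, rewire_comp_assoc, rewire_comp] at h'
  unfold learn
  simp only [comp_assoc]
  refine Eq.trans ?_ h'
  congr 2
  exact ((congrArg (fun D => comp _ (comp _ D)) (rewire_id _ _)).trans
    (congrArg (fun D => comp _ D) (comp_id _))).symm

theorem learn_comp_discard (A X : FinSet) :
    (learn A X).comp (rewire A (A.prod X) X fun x => x.2) = id ⟨A, X⟩ := by
  have h := congrArg (fun D => side D X) (know_discard A)
  simp only [side_comp, side_rewire] at h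
  have h' := congrArg (fun D => (rewire A X (FinSet.star.prod X) fun x => ((), x)).comp
    (D.comp (rewire A (FinSet.star.prod X) X fun x => x.2))) h
  simp only [comp_assoc, rewire_comp] at h'
  unfold learn
  rw [comp_assoc]
  refine h'.trans ?_
  rw [← rewire_id, side_rewire, rewire_comp, rewire_comp, rewire_id]

theorem apply_comp_apply (A B C Y : FinSet) :
    (apply A B ((B.hom C).prod Y)).comp (apply B C Y) =
      (rewire A ((A.hom B).prod ((B.hom C).prod Y)) ((A.hom C).prod Y)
        fun x => (fun a => x.2.1 (x.1 a), x.2.2)).comp (apply A C Y) := by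
  have h := congrArg (fun D => side D Y) (prep_prep A B C)
  simp only [side_comp, side_side, side_rewire] at h
  have h' := congrArg (fun D => (rewire A ((A.hom B).prod ((B.hom C).prod Y))
    (((A.hom B).prod (B.hom C)).prod Y) fun x => ((x.1, x.2.1), x.2.2)).comp
      (D.comp (rewire C (FinSet.star.prod Y) Y fun x => x.2))) h
  simp only [comp_assoc, rewire_comp_assoc] at h'
  unfold apply
  simp only [comp_assoc]
  refine Eq.trans ?_ h'
  exact ((congrArg (fun D => comp D _) (rewire_id _ _)).trans (id_comp _)).symm

theorem apply_comp_learn (A B Y : FinSet) :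
    (apply A B Y).comp (learn B Y) = (learn A ((A.hom B).prod Y)).comp
      ((rewire A (A.prod ((A.hom B).prod Y)) ((A.hom B).prod (B.prod Y))
        fun x => (x.2.1, (x.2.1 x.1, x.2.2))).comp (apply A B (B.prod Y))) := by
  have h := congrArg (fun D => side D Y) (prep_know A B)
  simp only [side_comp, side_side, side_rewire] at h
  simp only [comp_assoc, rewire_comp_assoc, rewire_comp] at h
  unfold apply learn
  simp only [comp_assoc, rewire_comp_assoc]
  refine Eq.trans ?_ h
  exact (congrArg (fun D => comp _ (comp D _)) (rewire_id _ _)).trans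
    (congrArg (fun D => comp _ D) (id_comp _))

theorem emb_comp_assoc {A B C X Y Z : FinSet} {T : Sys} (f : A → B) (g : B → C)
    (s : SubStoch X Y) (t : SubStoch Y Z) (D : CIProc ⟨C, Z⟩ T) :
    (emb f s).comp ((emb g t).comp D) = (emb (fun a => g (f a)) (s.comp t)).comp D := by
  rw [← comp_assoc, emb_comp]

/-- The process is given by acting on knowledge of its causal input: learn the causal input,
compute with a substochastic map a function together with the inferential output, and apply
the function. -/
def IsNormal {S T : Sys} (D : CIProc S T) : Prop :=
  ∃ K : SubStoch (S.caus.prod S.inf) ((S.caus.hom T.caus).prod T.inf),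
    D = (learn S.caus S.inf).comp
      ((emb (fun a => a) K).comp (apply S.caus T.caus T.inf))

theorem IsNormal.comp {S T U : Sys} {D : CIProc S T} {E : CIProc T U} (hD : IsNormal D)
    (hE : IsNormal E) : IsNormal (D.comp E) := by
  obtain ⟨K, rfl⟩ := hD
  obtain ⟨L, rfl⟩ := hE
  refine ⟨?_, ?_⟩
  rotate_left
  · simp only [comp_assoc]
    rw [← comp_assoc (apply _ _ _) (learn _ _), apply_comp_learn]
    simp only [comp_assoc]
    rw [← comp_assoc (apply _ _ _) (emb _ _), apply_comp_emb]
    simp only [comp_assoc]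
    rw [apply_comp_apply, ← comp_assoc (emb _ _) (learn _ _), emb_comp_learn]
    simp only [comp_assoc]
    rw [← comp_assoc (learn _ _) (learn _ _), learn_comp_learn]
    simp only [comp_assoc]
    unfold rewire wire
    simp only [emb_comp_assoc]
    rfl

theorem emb_eq_prep {A B : FinSet} (f : A → B) : emb f (SubStoch.id FinSet.star) =
    (rewire A FinSet.star (A.hom B) fun _ => f).comp (mk (Diagram.prep A B)) :=
  Quotient.sound (Rewrite.embed_eq f)

theorem emb_eq_apply {A B X Y : FinSet} (f : A → B) (s : SubStoch X Y) :
    emb f s = (emb (fun a => a) s).comp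
      ((rewire A Y ((A.hom B).prod Y) fun y => (f, y)).comp (apply A B Y)) := by
  have h := congrArg (fun D => side D Y) (emb_eq_prep f)
  simp only [side_comp, side_emb, side_rewire] at h
  have h' := congrArg (fun D => (rewire A Y (FinSet.star.prod Y) fun y => ((), y)).comp
    (D.comp (rewire B (FinSet.star.prod Y) Y fun y => y.2))) h
  simp only [comp_assoc, rewire_comp_assoc] at h'
  unfold apply
  refine Eq.trans ?_ (congrArg (fun D => comp _ D) h')
  unfold rewire wire SubStoch.id
  rw [SubStoch.det_tensor_det, emb_comp, emb_comp, emb_comp, SubStoch.det_comp_det,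
    SubStoch.det_comp_det]
  congr 1
  exact (SubStoch.comp_id _).symm

theorem isNormal_apply (A B Y : FinSet) : IsNormal (apply A B Y) := by
  refine ⟨SubStoch.det (X := A.prod ((A.hom B).prod Y)) fun x => x.2, ?_⟩
  rw [← comp_assoc]
  exact ((congrArg (fun D => comp D _) (learn_comp_discard A ((A.hom B).prod Y))).trans
    (id_comp _)).symm

theorem isNormal_learn (A X : FinSet) : IsNormal (learn A X) := by
  refine ⟨SubStoch.det fun x => (fun a => a, x), ?_⟩
  have h := emb_eq_apply (fun a : A => a) (SubStoch.id (A.prod X))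
  rw [emb_id, id_comp] at h
  exact ((congrArg (fun D => comp _ D) h.symm).trans (comp_id _)).symm

theorem isNormal_emb {A B X Y : FinSet} (f : A → B) (s : SubStoch X Y) :
    IsNormal (emb f s) := by
  refine ⟨((SubStoch.det (X := A.prod X) fun x => x.2).comp s).comp
    (SubStoch.det fun y => (f, y)), ?_⟩
  rw [emb_eq_apply f s, ← emb_comp (fun a : A => a) (fun a => a),
    ← emb_comp (fun a : A => a) (fun a => a)]
  simp only [comp_assoc]
  rw [← comp_assoc (learn _ _)]
  exact ((congrArg (fun D => comp D _) (learn_comp_discard A X)).trans (id_comp _)).symm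

theorem isNormal_wire {A B X Y : FinSet} (f : A → B) (g : X → Y) : IsNormal (wire f g) :=
  isNormal_emb _ _

theorem isNormal_id (S : Sys) : IsNormal (id S) :=
  emb_id S.caus S.inf ▸ isNormal_emb _ _

theorem isNormal_side_know (A X : FinSet) : IsNormal (side (mk (Diagram.know A)) X) := by
  rw [side_know]
  exact (isNormal_wire _ _).comp (isNormal_learn _ _)

theorem isNormal_side_prep (A B X : FinSet) : IsNormal (side (mk (Diagram.prep A B)) X) := by
  rw [side_prep]
  exact (isNormal_apply _ _ _).comp (isNormal_wire _ _)

theorem tensor_id_star {A B X Y : FinSet} (D : CIProc ⟨A, X⟩ ⟨B, Y⟩) (Z : FinSet) :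
    D.tensor (id ⟨FinSet.star, Z⟩) =
      (wire (A := A.prod FinSet.star) (fun a => a.1) fun x => x).comp
        ((side D Z).comp (wire (B := B.prod FinSet.star) (fun b => (b, ())) fun y => y)) := by
  unfold side
  simp only [comp_assoc, wire_comp, wire_comp_assoc]
  have h (C W : FinSet) : wire (A := C.prod FinSet.star) (B := C.prod FinSet.star) (X := W.prod Z)
      (fun c => (c.1, ())) (fun x => x) = id _ := wire_id _ _
  rw [h, h]
  exact ((id_comp _).trans (comp_id _)).symm

theorem eq_side_star {A B X Y : FinSet} (D : CIProc ⟨A, X⟩ ⟨B, Y⟩) :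
    D = (rewire A X (X.prod FinSet.star) fun x => (x, ())).comp
      ((side D FinSet.star).comp (rewire B (Y.prod FinSet.star) Y fun y => y.1)) := by
  have h := congrArg (fun E => (wire (B := A.prod FinSet.star) (Y := X.prod FinSet.star)
    (fun a => (a, ())) (fun x => (x, ()))).comp E) (right_unitor D)
  dsimp only at h
  have h' : (wire (B := A.prod FinSet.star) (Y := X.prod FinSet.star)
    (fun a => (a, ())) (fun x => (x, ()))).comp (mk (Diagram.rightUnitWire ⟨A, X⟩)) = id _ :=
    (wire_comp _ _ _ _).trans (wire_id _ _)
  rw [← comp_assoc _ _ D, h', id_comp] at h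
  unfold side rewire
  simp only [comp_assoc, wire_comp, wire_comp_assoc]
  exact h.symm

/-- The process next to any inferential wire is in normal form. -/
def IsNormalBeside {S T : Sys} (D : CIProc S T) : Prop :=
  ∀ Z : FinSet, IsNormal (D.tensor (id ⟨FinSet.star, Z⟩))

theorem IsNormalBeside.comp {S T U : Sys} {D : CIProc S T} {E : CIProc T U}
    (hD : IsNormalBeside D) (hE : IsNormalBeside E) : IsNormalBeside (D.comp E) := fun Z => by
  rw [comp_tensor_id]
  exact (hD Z).comp (hE Z)

theorem isNormal_emb_tensor {A B X Y : FinSet} (f : A → B) (s : SubStoch X Y) (U : Sys) :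
    IsNormal ((emb f s).tensor (id U)) := by
  rw [← emb_id, emb_tensor]
  exact isNormal_emb _ _

theorem isNormalBeside_emb {A B X Y : FinSet} (f : A → B) (s : SubStoch X Y) :
    IsNormalBeside (emb f s) := fun _ => isNormal_emb_tensor f s _

theorem isNormalBeside_of_side {A B X Y : FinSet} {D : CIProc ⟨A, X⟩ ⟨B, Y⟩}
    (h : ∀ Z, IsNormal (side D Z)) : IsNormalBeside D := fun Z => by
  rw [tensor_id_star]
  exact (isNormal_wire _ _).comp ((h Z).comp (isNormal_wire _ _))

theorem tensor_assoc {S T S' T' S'' T'' : Sys} (D : CIProc S T) (D' : CIProc S' T')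
    (D'' : CIProc S'' T'') : D.tensor (D'.tensor D'') =
      (wire (A := S.caus.prod (S'.caus.prod S''.caus)) (B := (S.caus.prod S'.caus).prod S''.caus)
        (X := S.inf.prod (S'.inf.prod S''.inf)) (Y := (S.inf.prod S'.inf).prod S''.inf)
        (fun a => ((a.1, a.2.1), a.2.2)) (fun x => ((x.1, x.2.1), x.2.2))).comp
      (((D.tensor D').tensor D'').comp (mk (Diagram.assocWire T T' T''))) := by
  rw [associator, ← comp_assoc]
  have h : (wire (A := S.caus.prod (S'.caus.prod S''.caus))
      (B := (S.caus.prod S'.caus).prod S''.caus)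
      (X := S.inf.prod (S'.inf.prod S''.inf)) (Y := (S.inf.prod S'.inf).prod S''.inf)
      (fun a => ((a.1, a.2.1), a.2.2)) (fun x => ((x.1, x.2.1), x.2.2))).comp
      (mk (Diagram.assocWire S S' S'')) = id _ :=
    (wire_comp _ _ _ _).trans (wire_id _ _)
  rw [h, id_comp]

theorem id_eq_tensor (C Z : FinSet) : id ⟨C, Z⟩ =
    (wire (B := C.prod FinSet.star) (Y := FinSet.star.prod Z) (fun c => (c, ()))
      (fun z => ((), z))).comp (((id ⟨C, FinSet.star⟩).tensor (id ⟨FinSet.star, Z⟩)).comp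
      (wire (A := C.prod FinSet.star) (X := FinSet.star.prod Z) (fun c => c.1)
        (fun z => z.2))) := by
  rw [id_tensor, id_comp, wire_comp]
  exact (wire_id _ _).symm

theorem isNormal_tensor_id_of_beside {S T : Sys} {D : CIProc S T} {C : FinSet}
    (h : IsNormalBeside (D.tensor (id ⟨C, FinSet.star⟩))) (Z : FinSet) :
    IsNormal (D.tensor (id ⟨C, Z⟩)) := by
  rw [id_eq_tensor, ← id_comp D, ← comp_id D, comp_tensor_comp, comp_tensor_comp,
    tensor_assoc]
  refine IsNormal.comp ?_ (IsNormal.comp (IsNormal.comp (isNormal_wire _ _)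
    (IsNormal.comp (h Z) (isNormal_wire _ _))) ?_)
  · exact id_tensor_wire (A := C) _ _ _ _ ▸ isNormal_wire _ _
  · exact id_tensor_wire (B := C) _ _ _ _ ▸ isNormal_wire _ _

theorem ignore_eq_emb (A : FinSet) :
    mk (Diagram.ignore A) = emb (fun _ => ()) (SubStoch.id FinSet.star) := by
  have h1 : (mk (Diagram.prep A FinSet.star)).comp (mk (Diagram.ignore FinSet.star)) =
      (rewire A (A.hom FinSet.star) FinSet.star fun _ => ()).comp (mk (Diagram.ignore A)) :=
    Quotient.sound (Rewrite.prep_ignore A FinSet.star)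
  have h2 : mk (Diagram.ignore FinSet.star) = id Sys.unit := Quotient.sound Rewrite.ignore_star
  rw [h2, comp_id] at h1
  rw [emb_eq_prep, h1, rewire_comp_assoc]
  exact ((congrArg (fun D => comp D _) (rewire_id _ _)).trans (id_comp _)).symm

theorem know_tensor (A B : FinSet) : (mk (Diagram.know A)).tensor (mk (Diagram.know B)) =
    (rewire (A.prod B) (FinSet.star.prod FinSet.star) FinSet.star fun x => x.1).comp
      (mk (Diagram.know (A.prod B))) :=
  Quotient.sound (Rewrite.know_tensor A B)

theorem prep_tensor (A B A' B' : FinSet) :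
    ((mk (Diagram.prep A B)).tensor (mk (Diagram.prep A' B'))).comp
      (rewire (B.prod B') (FinSet.star.prod FinSet.star) FinSet.star fun x => x.1) =
    (rewire (A.prod A') ((A.hom B).prod (A'.hom B')) ((A.prod A').hom (B.prod B'))
      fun x a => (x.1 a.1, x.2 a.2)).comp (mk (Diagram.prep (A.prod A') (B.prod B'))) :=
  Quotient.sound (Rewrite.prep_tensor A B A' B')

theorem isNormalBeside_know (A : FinSet) : IsNormalBeside (mk (Diagram.know A)) :=
  isNormalBeside_of_side (isNormal_side_know A)

theorem isNormalBeside_prep (A B : FinSet) : IsNormalBeside (mk (Diagram.prep A B)) :=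
  isNormalBeside_of_side (isNormal_side_prep A B)

theorem isNormal_know_tensor (A : FinSet) (U : Sys) :
    IsNormal ((mk (Diagram.know A)).tensor (id U)) := by
  refine isNormal_tensor_id_of_beside (C := U.caus) ?_ U.inf
  rw [← know_discard, ← comp_id (mk (Diagram.know A)), comp_tensor_comp, know_tensor]
  refine (IsNormalBeside.comp (isNormalBeside_emb _ _) (isNormalBeside_know _)).comp ?_
  exact id_tensor_wire (A := U.caus) _ _ _ _ ▸ isNormalBeside_emb _ _

theorem isNormal_prep_tensor (A B : FinSet) (U : Sys) :
    IsNormal ((mk (Diagram.prep A B)).tensor (id U)) := by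
  refine isNormal_tensor_id_of_beside (C := U.caus) ?_ U.inf
  rw [← emb_id, emb_eq_prep, ← id_comp (mk (Diagram.prep A B)), comp_tensor_comp]
  refine IsNormalBeside.comp (id_tensor_wire (A := U.caus) _ _ _ _ ▸ isNormalBeside_emb _ _) ?_
  have h := congrArg (fun D => comp D (rewire (B.prod U.caus) FinSet.star
    (FinSet.star.prod FinSet.star) fun x => (x, ()))) (prep_tensor A B U.caus U.caus)
  simp only [comp_assoc, rewire_comp] at h
  have h' : ((mk (Diagram.prep A B)).tensor (mk (Diagram.prep U.caus U.caus))) = _ :=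
    ((congrArg (fun D => comp _ D) (rewire_id _ _)).trans (comp_id _)).symm.trans h
  rw [h']
  exact IsNormalBeside.comp (isNormalBeside_emb _ _)
    (IsNormalBeside.comp (isNormalBeside_prep _ _) (isNormalBeside_emb _ _))

theorem id_tensor_eq_swap {S T : Sys} (D : CIProc S T) (U : Sys) : (id U).tensor D =
    (mk (Diagram.swapWire U S)).comp ((D.tensor (id U)).comp (mk (Diagram.swapWire T U))) := by
  rw [swap, ← comp_assoc]
  have h : (mk (Diagram.swapWire U S)).comp (mk (Diagram.swapWire S U)) = id _ :=
    (wire_comp _ _ _ _).trans (wire_id _ _)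
  rw [h, id_comp]

theorem isNormal_tensor_id {S T : Sys} (D : Diagram S T) (U : Sys) :
    IsNormal ((mk D).tensor (id U)) := by
  induction D generalizing U with
  | embed f s => exact isNormal_emb_tensor f s U
  | prep A B => exact isNormal_prep_tensor A B U
  | know A => exact isNormal_know_tensor A U
  | ignore A =>
    rw [ignore_eq_emb]
    exact isNormal_emb_tensor _ _ U
  | id S => exact id_tensor S U ▸ isNormal_id _
  | comp D E hD hE =>
    change IsNormal (((mk D).comp (mk E)).tensor (CIProc.id U))
    rw [comp_tensor_id]
    exact (hD U).comp (hE U)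
  | @tensor S T S' T' D E hD hE =>
    change IsNormal (((mk D).tensor (mk E)).tensor (CIProc.id U))
    rw [tensor_tensor, tensor_eq (mk D), id_tensor_eq_swap, tensor_tensor, id_tensor]
    refine (isNormal_wire _ _).comp (IsNormal.comp ((hD _).comp ?_) (isNormal_wire _ _))
    refine (isNormal_wire _ _).comp (IsNormal.comp ?_ (isNormal_wire _ _))
    exact (isNormal_wire _ _).comp ((hE _).comp (isNormal_wire _ _))

theorem isNormal {S T : Sys} (D : CIProc S T) : IsNormal D := by
  induction D using Quotient.inductionOn with | h D => ?_
  have h := eq_side_star (mk D)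
  change IsNormal (mk D)
  rw [h]
  exact (isNormal_wire _ _).comp (IsNormal.comp ((isNormal_wire _ _).comp
    ((isNormal_tensor_id D _).comp (isNormal_wire _ _))) (isNormal_wire _ _))

theorem learn_star (X : FinSet) : learn FinSet.star X =
    rewire FinSet.star X (FinSet.star.prod X) fun x => ((), x) := by
  have h : mk (Diagram.know FinSet.star) = rewire _ _ _ fun x => x :=
    (comp_id _).symm.trans ((congrArg (fun D => comp _ D) (rewire_id _ _).symm).trans
      ((know_discard FinSet.star).trans (rewire_id _ _).symm))
  unfold learn
  rw [h, side_rewire, rewire_comp]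

theorem apply_star (X : FinSet) : apply FinSet.star FinSet.star X =
    rewire FinSet.star ((FinSet.star.hom FinSet.star).prod X) X fun x => x.2 := by
  have h1 : (mk (Diagram.prep FinSet.star FinSet.star)).comp (mk (Diagram.ignore FinSet.star)) =
      (rewire _ _ _ fun _ => ()).comp (mk (Diagram.ignore FinSet.star)) :=
    Quotient.sound (Rewrite.prep_ignore FinSet.star FinSet.star)
  have h2 : mk (Diagram.ignore FinSet.star) = id Sys.unit := Quotient.sound Rewrite.ignore_star
  rw [h2, comp_id, comp_id] at h1
  unfold apply
  rw [h1, side_rewire, rewire_comp]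

theorem exists_eq_incl {X Y : FinSet} (D : CIProc ⟨FinSet.star, X⟩ ⟨FinSet.star, Y⟩) :
    ∃ s : SubStoch X Y, D = incl s := by
  obtain ⟨K, h⟩ := isNormal D
  rw [learn_star, apply_star] at h
  unfold rewire wire at h
  rw [emb_comp, emb_comp] at h
  exact ⟨_, h⟩

theorem sem_comp {S T U : Sys} (D : CIProc S T) (E : CIProc T U) :
    (D.comp E).sem = D.sem.comp E.sem := by
  induction D using Quotient.inductionOn
  induction E using Quotient.inductionOn
  rfl

theorem sem_tensor_congr {S T S' T' : Sys} {D E : CIProc S T} (h : D.sem = E.sem)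
    (F : CIProc S' T') : (D.tensor F).sem = (E.tensor F).sem := by
  induction D using Quotient.inductionOn with | h D => ?_
  induction E using Quotient.inductionOn with | h E => ?_
  induction F using Quotient.inductionOn with | h F => ?_
  change (D.tensor F).sem = (E.tensor F).sem
  change D.sem = E.sem at h
  ext x y : 3
  rw [Diagram.sem_tensor_weight, Diagram.sem_tensor_weight, h]

theorem sem_prepareInput (A X : FinSet) : (prepareInput A X).sem =
    SubStoch.det (X := FinSet.star.prod (X.prod A)) (Y := A.prod X)
      fun x => (x.2.2, x.2.1) :=
  Diagram.isDet_comp (Diagram.isDet_embed _ _) (Diagram.isDet_comp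
    (Diagram.isDet_nextTo (Diagram.isDet_prep _ _) _) (Diagram.isDet_embed _ _))

theorem sem_learnOutput (B Y : FinSet) : (learnOutput B Y).sem =
    SubStoch.det (X := B.prod Y) (Y := FinSet.star.prod (Y.prod B))
      fun x => ((), (x.2, x.1)) :=
  Diagram.isDet_comp (Diagram.isDet_embed _ _) (Diagram.isDet_comp
    (Diagram.isDet_nextTo (Diagram.isDet_know _) _) (Diagram.isDet_comp
    (Diagram.isDet_embed _ _) (Diagram.isDet_comp
    (Diagram.isDet_nextTo (Diagram.isDet_ignore _) _) (Diagram.isDet_embed _ _))))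

end CIProc

theorem PredictionMap.pred_weight (p : PredictionMap) {X Y : FinSet}
    (D : CIProc ⟨FinSet.star, X⟩ ⟨FinSet.star, Y⟩) (x : X) (y : Y) :
    (p.pred D).weight x y = D.sem.weight ((), x) ((), y) := by
  obtain ⟨s, rfl⟩ := D.exists_eq_incl
  rw [p.pred_incl]
  exact (congrArg (fun t => SubStoch.weight t x y) (evalPrediction.pred_incl s)).symm

theorem assocMap_weight (p : PredictionMap) {S T : Sys} (D : CIProc S T)
    (x : S.inf.prod S.caus) (y : T.inf.prod T.caus) :
    (assocMap p D).weight x y = D.sem.weight (x.2, x.1) (y.2, y.1) := by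
  unfold assocMap
  rw [PredictionMap.pred_weight, CIProc.sem_comp, CIProc.sem_comp, CIProc.sem_prepareInput,
    CIProc.sem_learnOutput, SubStoch.det_comp]
  exact SubStoch.comp_det_equiv (Y := T.caus.prod T.inf) D.sem (fun z => ((), (z.2, z.1)))
    (fun z : FinSet.star.prod (T.inf.prod T.caus) => (z.2.2, z.2.1))
    (fun _ => rfl) (fun _ => rfl) _ _

theorem assocMap_eq_iff (p : PredictionMap) {S T : Sys} (D E : CIProc S T) :
    assocMap p D = assocMap p E ↔ D.sem = E.sem := by
  constructor
  · intro h
    ext x y : 3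
    have h' := congrArg (fun t => SubStoch.weight t (x.2, x.1) (y.2, y.1)) h
    simpa only [assocMap_weight] using h'
  · intro h
    ext x y : 3
    rw [assocMap_weight, assocMap_weight, h]

/-- The tester that prepares the causal input and learns the causal output. -/
def assocTester (S T : Sys) : Tester S T where
  aux := Sys.unit
  inp := S.inf.prod S.caus
  out := T.inf.prod T.caus
  before := (prepareInput S.caus S.inf).comp (CIProc.wire (B := S.caus.prod FinSet.star)
    (Y := S.inf.prod FinSet.star) (fun a => (a, ())) (fun x => (x, ())))
  after := (CIProc.mk (Diagram.rightUnitWire T)).comp (learnOutput T.caus T.inf)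

theorem assocTester_insert {S T : Sys} (D : CIProc S T) : (assocTester S T).insert D =
    (prepareInput S.caus S.inf).comp (D.comp (learnOutput T.caus T.inf)) := by
  unfold Tester.insert assocTester
  dsimp only
  rw [← CIProc.comp_assoc (D.tensor _), CIProc.right_unitor, CIProc.comp_assoc, CIProc.comp_assoc,
    ← CIProc.comp_assoc (CIProc.wire _ _)]
  have h : (CIProc.wire (A := S.caus) (B := S.caus.prod FinSet.star) (X := S.inf)
    (Y := S.inf.prod FinSet.star) (fun a => (a, ())) (fun x => (x, ()))).comp
      (CIProc.mk (Diagram.rightUnitWire S)) = CIProc.id S :=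
    (CIProc.wire_comp _ _ _ _).trans (CIProc.wire_id _ _)
  rw [h, CIProc.id_comp]

theorem lemma6 (p : PredictionMap) {S T : Sys} (D E : CIProc S T) :
    InfEquiv p D E ↔ assocMap p D = assocMap p E := by
  constructor
  · intro h
    have h' := h (assocTester S T)
    rwa [assocTester_insert, assocTester_insert] at h'
  · intro h τ
    rw [assocMap_eq_iff] at h
    ext x y : 3
    rw [PredictionMap.pred_weight, PredictionMap.pred_weight]
    unfold Tester.insert
    rw [CIProc.sem_comp, CIProc.sem_comp, CIProc.sem_comp, CIProc.sem_comp,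
      CIProc.sem_tensor_congr h]
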